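/- Let $n\ge 1$ and $N=n+1$, and write points of $\mathbb{R}^N=\mathbb{R}^{n}\times\mathbb{R}$ as $x=(x',x_N)$. Let $\omega\subset\mathbb{R}^{n}$ be a bounded domain (nonempty, open, connected) with $C^\infty$ boundary, let $\mathcal{C}_\omega=\omega\times(0,+\infty)$ be the half-cylinder spanned by $\omega$, and let $\partial\mathcal{C}_\omega^+=\partial\mathcal{C}_\omega\cap\{x_N>0\}$ be the lateral part of its boundary. Let $\varphi\in C^2(\bar\omega)$ satisfy $\varphi>0$ on $\bar\omega$, and let $$\Gamma_\varphi=\{(x',x_N): x'\in\omega,\ x_N=\varphi(x')\}\subset\mathcal{C}_\omega$$ be its cartesian graph. The mean curvature of $\Gamma_\varphi$ at a point is $\frac1{N-1}$ times the trace of the shape operator $v\mapsto D_v\nu$ on the tangent space of $\Gamma_\varphi$, where $\nu$ is the unit normal field of $\Gamma_\varphi$ exterior to $\Omega_\varphi=\{(x',x_N): x'\in\omega,\ 0<x_N<\varphi(x')\}$. Assume that 1. $\Gamma_\varphi$ has constant mean curvature $H$, and 2. $\Gamma_\varphi$ meets $\partial\mathcal{C}_\omega^+$ orthogonally, that is, at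 every point of $\overline{\Gamma_\varphi}\cap\partial\mathcal{C}_\omega^+$ the normals to $\overline{\Gamma_\varphi}$ and to $\partial\mathcal{C}_\omega^+$ are orthogonal. Then $H=0$, i.e. $\Gamma_\varphi$ is a minimal hypersurface, and $\varphi$ is constant on $\bar\omega$. -/

import Mathlib

open scoped Topology

noncomputable section

namespace CMCGraph

/-- `ℝⁿ` with its Euclidean structure. -/
abbrev Base (n : ℕ) : Type := EuclideanSpace ℝ (Fin n)

/-- `ℝᴺ = ℝⁿ × ℝ`, `N = n + 1`, with its Euclidean structure; a point is `x = (x', x_N)`,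
where `x' = x.fst` and `x_N = x.snd`. -/
abbrev Ambient (n : ℕ) : Type := WithLp 2 (Base n × ℝ)

/-- A smooth bounded domain: a nonempty bounded connected open set which near each of its boundary
points is the sublevel set of a `C^∞` function with nonvanishing differential. -/
structure IsSmoothBoundedDomain {n : ℕ} (ω : Set (Base n)) : Prop where
  isOpen : IsOpen ω
  isConnected : IsConnected ω
  isBounded : Bornology.IsBounded ω
  smooth_boundary : ∀ p ∈ frontier ω, ∃ (U : Set (Base n)) (ρ : Base n → ℝ),
    IsOpen U ∧ p ∈ U ∧ ContDiffOn ℝ ((⊤ : ℕ∞) : WithTop ℕ∞) ρ U ∧ fderiv ℝ ρ p ≠ 0 ∧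
      ω ∩ U = {x | x ∈ U ∧ ρ x < 0}

/-- The half-cylinder `ω × (0, ∞)`. -/
def halfCylinder {n : ℕ} (ω : Set (Base n)) : Set (Ambient n) :=
  {x | x.fst ∈ ω ∧ 0 < x.snd}

/-- The lateral part `∂(ω × (0, ∞)) ∩ {x_N > 0}` of the boundary of the half-cylinder. -/
def lateralBoundary {n : ℕ} (ω : Set (Base n)) : Set (Ambient n) :=
  frontier (halfCylinder ω) ∩ {x | 0 < x.snd}

/-- The cartesian graph of `φ` over `ω`. -/
def graph {n : ℕ} (ω : Set (Base n)) (φ : Base n → ℝ) : Set (Ambient n) :=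
  {x | x.fst ∈ ω ∧ x.snd = φ x.fst}

/-- The part of the half-cylinder below the graph of `φ`. -/
def subgraph {n : ℕ} (ω : Set (Base n)) (φ : Base n → ℝ) : Set (Ambient n) :=
  {x | x.fst ∈ ω ∧ 0 < x.snd ∧ x.snd < φ x.fst}

section Geometry

variable {E : Type*} [NormedAddCommGroup E] [InnerProductSpace ℝ E] [FiniteDimensional ℝ E]

/-- The tangent space of `S` at `p`, spanned by the limits of (rescaled) secants of `S` at `p`.
For a `C¹` hypersurface, with or without boundary, this is the usual tangent hyperplane. -/
def tangentSpaceAt (S : Set E) (p : E) : Submodule ℝ E :=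
  Submodule.span ℝ (tangentConeAt ℝ S p)

/-- The normal space of `S` at `p`. -/
def normalSpaceAt (S : Set E) (p : E) : Submodule ℝ E :=
  (tangentSpaceAt S p)ᗮ

/-- `ν` is, along `Γ`, the unit normal field pointing out of `Ω`
(`Γ` being a part of the boundary of `Ω`). -/
structure IsExteriorUnitNormal (Ω Γ : Set E) (ν : E → E) : Prop where
  norm_eq_one : ∀ p ∈ Γ, ‖ν p‖ = 1
  normal : ∀ p ∈ Γ, ν p ∈ normalSpaceAt Γ p
  outside : ∀ p ∈ Γ, ∀ᶠ t : ℝ in 𝓝[>] 0, p + t • ν p ∉ Ω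
  inside : ∀ p ∈ Γ, ∀ᶠ t : ℝ in 𝓝[>] 0, p - t • ν p ∈ Ω

/-- The shape operator `v ↦ D_v ν` of `Γ` at `p`, as an endomorphism of the tangent space
(positive on round spheres with the exterior normal). -/
def shapeOperator (Γ : Set E) (ν : E → E) (p : E) :
    tangentSpaceAt Γ p →ₗ[ℝ] tangentSpaceAt Γ p :=
  (tangentSpaceAt Γ p).orthogonalProjectionOnto.toLinearMap ∘ₗ
    (fderivWithin ℝ ν Γ p).toLinearMap ∘ₗ (tangentSpaceAt Γ p).subtype

/-- The mean curvature at `p` of the hypersurface `Γ` with unit normal field `ν`: the trace of the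
shape operator divided by the dimension of `Γ`. -/
def meanCurvature (Γ : Set E) (ν : E → E) (p : E) : ℝ :=
  LinearMap.trace ℝ (tangentSpaceAt Γ p) (shapeOperator Γ ν p) /
    Module.finrank ℝ (tangentSpaceAt Γ p)

/-- `Γ` has constant mean curvature `H` with respect to the unit normal exterior to `Ω`. -/
def HasConstantMeanCurvature (Ω Γ : Set E) (H : ℝ) : Prop :=
  ∃ ν : E → E, IsExteriorUnitNormal Ω Γ ν ∧ DifferentiableOn ℝ ν Γ ∧
    ∀ p ∈ Γ, meanCurvature Γ ν p = H

/-- The hypersurface `Γ` meets the hypersurface `S` orthogonally: at every common point of `S` and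
of the closure of `Γ` the normals to the two hypersurfaces are orthogonal. -/
def MeetsOrthogonally (Γ S : Set E) : Prop :=
  ∀ p ∈ closure Γ ∩ S, ∀ a ∈ normalSpaceAt (closure Γ) p, ∀ b ∈ normalSpaceAt S p,
    inner ℝ a b = 0

end Geometry

end CMCGraph

end

/-! In the parametrization of the graph by `ω`, constant mean curvature reads
`tr (g⁻¹ D²φ) = -n H √(1 + |∇φ|²)`, where `g = I + ∇φ ⊗ ∇φ` is the first fundamental form. With the
coefficients `g⁻¹` frozen this is a linear equation, uniformly elliptic because `∇φ` is bounded, so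
`φ` (if `H ≤ 0`) or `-φ` (if `H ≥ 0`) is a subsolution. Orthogonality to the cylinder is the
homogeneous Neumann condition, under which Hopf's lemma and the strong maximum principle make a
subsolution constant. The equation then gives `H = 0`.
-/

noncomputable section

namespace CMCGraph

open Set Filter Metric Module
open scoped Gradient RealInnerProductSpace

section Hessian

theorem second_deriv_nonpos_of_isLocalMax {f f' : ℝ → ℝ} {a c : ℝ}
    (hf : ∀ᶠ t in 𝓝 a, HasDerivAt f (f' t) t) (hf' : HasDerivAt f' c a)
    (hmax : IsLocalMax f a) : c ≤ 0 := by
  by_contra! hc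
  have hd : deriv f =ᶠ[𝓝 a] f' := hf.mono fun t ht => ht.deriv
  have hmin : IsLocalMin f a := by
    refine isLocalMin_of_deriv_deriv_pos ?_ hmax.deriv_eq_zero hf.self_of_nhds.continuousAt
    rwa [hd.deriv_eq, hf'.deriv]
  have hconst : f =ᶠ[𝓝 a] fun _ => f a := by
    filter_upwards [hmax, hmin] with t h1 h2 using le_antisymm h1 h2
  have hf'0 : f' =ᶠ[𝓝 a] fun _ => 0 := hd.symm.trans (by simpa using hconst.deriv)
  exact hc.ne ((hasDerivAt_const a (0 : ℝ)).unique (hf'.congr_of_eventuallyEq hf'0.symm))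

variable {E : Type*} [NormedAddCommGroup E] [InnerProductSpace ℝ E]

/-- Hopf's barrier `exp (-α |p - y|²)`. -/
def gaussian (α : ℝ) (y p : E) : ℝ :=
  Real.exp (-α * ‖p - y‖ ^ 2)

theorem contDiff_gaussian {m : WithTop ℕ∞} (α : ℝ) (y : E) : ContDiff ℝ m (gaussian α y) :=
  (contDiff_const.mul ((contDiff_id.sub contDiff_const).norm_sq ℝ)).exp

variable [CompleteSpace E]

/-- The Hessian of `u` at `x`, as an endomorphism: the derivative of the gradient. -/
def hessian (u : E → ℝ) (x : E) : E →L[ℝ] E :=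
  fderiv ℝ (∇ u) x

theorem hasGradientAt_add {f g : E → ℝ} {f' g' x : E} (hf : HasGradientAt f f' x)
    (hg : HasGradientAt g g' x) : HasGradientAt (fun p => f p + g p) (f' + g') x := by
  rw [hasGradientAt_iff_hasFDerivAt, map_add]
  exact hf.hasFDerivAt.add hg.hasFDerivAt

theorem hasGradientAt_const_mul {f : E → ℝ} {f' x : E} (c : ℝ) (hf : HasGradientAt f f' x) :
    HasGradientAt (fun p => c * f p) (c • f') x := by
  rw [hasGradientAt_iff_hasFDerivAt, map_smul]
  exact hf.hasFDerivAt.const_mul c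

theorem hasGradientAt_of_contDiffAt {u : E → ℝ} {x : E} (hu : ContDiffAt ℝ 2 u x) :
    ∀ᶠ p in 𝓝 x, HasGradientAt u (∇ u p) p :=
  (hu.eventually (by norm_num)).mono fun _ hp => (hp.differentiableAt (by norm_num)).hasGradientAt

theorem hasFDerivAt_gradient {u : E → ℝ} {x : E} (hu : ContDiffAt ℝ 2 u x) :
    HasFDerivAt (∇ u) (hessian u x) x := by
  have h : DifferentiableAt ℝ (fderiv ℝ u) x :=
    (hu.fderiv_right (m := 1) (by norm_num)).differentiableAt (by norm_num)
  exact ((InnerProductSpace.toDual ℝ E).symm.toContinuousLinearEquiv.differentiableAt.comp x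
    h).hasFDerivAt

theorem hessian_eq {u : E → ℝ} {G : E → E} {G' : E →L[ℝ] E} {x : E}
    (hu : ∀ᶠ p in 𝓝 x, HasGradientAt u (G p) p) (hG : HasFDerivAt G G' x) :
    hessian u x = G' :=
  (hG.congr_of_eventuallyEq (hu.mono fun _ hp => hp.gradient)).fderiv

theorem hessian_eq_zero_of_eventuallyEq_const {u : E → ℝ} {x : E} {c : ℝ}
    (hu : u =ᶠ[𝓝 x] fun _ => c) : hessian u x = 0 := by
  rw [hessian, hu.gradient.fderiv_eq, gradient_fun_const', fderiv_const_apply]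

theorem inner_hessian_nonpos_of_isLocalMax {u : E → ℝ} {x : E} (hu : ContDiffAt ℝ 2 u x)
    (hmax : IsLocalMax u x) (v : E) : ⟪v, hessian u x v⟫ ≤ 0 := by
  have hline : ∀ t : ℝ, HasDerivAt (fun t : ℝ => x + t • v) v t := fun t => by
    simpa using ((hasDerivAt_id t).smul_const v).const_add x
  have hcont : Tendsto (fun t : ℝ => x + t • v) (𝓝 0) (𝓝 x) := by
    simpa [ContinuousAt] using (hline 0).continuousAt
  have hfirst : ∀ᶠ t : ℝ in 𝓝 0,
      HasDerivAt (fun t : ℝ => u (x + t • v)) ⟪v, ∇ u (x + t • v)⟫ t := by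
    filter_upwards [hcont.eventually (hasGradientAt_of_contDiffAt hu)] with t ht
    refine (ht.hasFDerivAt.comp_hasDerivAt t (hline t)).congr_deriv ?_
    rw [InnerProductSpace.toDual_apply_apply, real_inner_comm]
  have hsecond : HasDerivAt (fun t : ℝ => ⟪v, ∇ u (x + t • v)⟫) ⟪v, hessian u x v⟫ 0 := by
    have h : HasFDerivAt (∇ u) (hessian u x) (x + (0 : ℝ) • v) := by
      simpa using hasFDerivAt_gradient hu
    simpa using (hasDerivAt_const (0 : ℝ) v).inner ℝ (h.comp_hasDerivAt (0 : ℝ) (hline 0))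
  refine second_deriv_nonpos_of_isLocalMax hfirst hsecond ?_
  simpa [IsLocalMax, IsMaxFilter] using hcont.eventually hmax

theorem hasGradientAt_gaussian (α : ℝ) (y p : E) :
    HasGradientAt (gaussian α y) ((-2 * α * gaussian α y p) • (p - y)) p := by
  rw [hasGradientAt_iff_hasFDerivAt]
  refine ((((hasFDerivAt_id p).sub_const y).norm_sq).const_mul (-α)).exp.congr_fderiv ?_
  ext v
  simp only [gaussian, id_eq, neg_mul, map_sub, ContinuousLinearMap.comp_id, neg_smul, smul_neg,
    neg_apply, smul_apply, sub_apply, coe_innerSL_apply, nsmul_eq_mul, Nat.cast_ofNat, smul_eq_mul,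
    map_neg, map_smul, InnerProductSpace.toDual_apply_apply, neg_inj]
  ring

theorem hessian_gaussian_apply (α : ℝ) (y x v : E) :
    hessian (gaussian α y) x v
      = gaussian α y x • ((4 * α ^ 2 * ⟪x - y, v⟫) • (x - y) - (2 * α) • v) := by
  have hG : HasFDerivAt (fun p => (-2 * α * gaussian α y p) • (p - y)) _ x :=
    ((hasGradientAt_gaussian α y x).hasFDerivAt.const_mul (-2 * α)).smul
      ((hasFDerivAt_id x).sub_const y)
  rw [hessian_eq (Eventually.of_forall (hasGradientAt_gaussian α y)) hG]
  simp only [neg_mul, neg_smul, map_neg, map_smul, map_sub, smul_neg, neg_neg, add_apply, neg_apply,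
    smul_apply, ContinuousLinearMap.id_apply, ContinuousLinearMap.smulRight_apply, sub_apply,
    InnerProductSpace.toDual_apply_apply, smul_eq_mul, inner_sub_left]
  module

end Hessian

section SecondOrder

variable {E : Type*} [NormedAddCommGroup E] [InnerProductSpace ℝ E]

/-- Uniform ellipticity on `s` of the symmetric coefficient field `A` of a second order operator. -/
structure IsUniformlyEllipticOn (A : E → E →L[ℝ] E) (s : Set E) : Prop where
  isSymmetric : ∀ x ∈ s, (A x).toLinearMap.IsSymmetric
  exists_bounds : ∃ l > 0, ∃ L, ∀ x ∈ s, ∀ v, l * ‖v‖ ^ 2 ≤ ⟪v, A x v⟫ ∧ ⟪v, A x v⟫ ≤ L * ‖v‖ ^ 2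

theorem IsUniformlyEllipticOn.mono {A : E → E →L[ℝ] E} {s t : Set E}
    (hA : IsUniformlyEllipticOn A t) (hst : s ⊆ t) : IsUniformlyEllipticOn A s where
  isSymmetric x hx := hA.isSymmetric x (hst hx)
  exists_bounds := by
    obtain ⟨l, hl, L, h⟩ := hA.exists_bounds
    exact ⟨l, hl, L, fun x hx => h x (hst hx)⟩

theorem IsUniformlyEllipticOn.isPositive {A : E → E →L[ℝ] E} {s : Set E}
    (hA : IsUniformlyEllipticOn A s) {x : E} (hx : x ∈ s) : (A x).IsPositive := by
  obtain ⟨l, hl, L, h⟩ := hA.exists_bounds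
  refine ⟨hA.isSymmetric x hx, fun v => ?_⟩
  rw [ContinuousLinearMap.reApplyInnerSelf_apply, RCLike.re_to_real, real_inner_comm]
  exact (by positivity : 0 ≤ l * ‖v‖ ^ 2).trans (h x hx v).1

variable [FiniteDimensional ℝ E]

/-- The value `tr (A D²u)` at `x` of a second order operator in nondivergence form, without lower
order terms and with coefficient matrix `A`. -/
def traceHessian (A : E →L[ℝ] E) (u : E → ℝ) (x : E) : ℝ :=
  LinearMap.trace ℝ E (A ∘L hessian u x).toLinearMap

theorem traceHessian_add_const_mul (A : E →L[ℝ] E) {u v : E → ℝ} {x : E} (c : ℝ)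
    (hu : ContDiffAt ℝ 2 u x) (hv : ContDiffAt ℝ 2 v x) :
    traceHessian A (fun p => u p + c * v p) x = traceHessian A u x + c * traceHessian A v x := by
  have hgrad : ∀ᶠ p in 𝓝 x, HasGradientAt (fun p => u p + c * v p) (∇ u p + c • ∇ v p) p := by
    filter_upwards [hasGradientAt_of_contDiffAt hu, hasGradientAt_of_contDiffAt hv] with p hp hp'
    exact hasGradientAt_add hp (hasGradientAt_const_mul c hp')
  have hhess := hessian_eq hgrad ((hasFDerivAt_gradient hu).add
    ((hasFDerivAt_gradient hv).const_smul c))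
  simp [traceHessian, hhess]

theorem traceHessian_neg (A : E →L[ℝ] E) {u : E → ℝ} {x : E} (hu : ContDiffAt ℝ 2 u x) :
    traceHessian A (-u) x = -traceHessian A u x := by
  have h := traceHessian_add_const_mul A (-1) (contDiffAt_const (c := (0 : ℝ))) hu
  have h0 : traceHessian A (fun _ => 0) x = 0 := by
    simp [traceHessian, hessian, gradient_fun_const']
  rw [h0] at h
  simpa [Pi.neg_def] using h

theorem trace_comp_nonpos {A M : E →ₗ[ℝ] E} (hA : A.IsPositive) (hM : ∀ v, ⟪v, M v⟫ ≤ 0) :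
    LinearMap.trace ℝ E (A ∘ₗ M) ≤ 0 := by
  let b := hA.isSymmetric.eigenvectorBasis rfl
  rw [LinearMap.trace_eq_sum_inner _ b]
  refine Finset.sum_nonpos fun i _ => ?_
  have hterm : ⟪b i, (A ∘ₗ M) (b i)⟫ = hA.isSymmetric.eigenvalues rfl i * ⟪b i, M (b i)⟫ := by
    rw [LinearMap.comp_apply, ← hA.isSymmetric,
      hA.isSymmetric.apply_eigenvectorBasis, inner_smul_left]
    simp [b]
  rw [hterm]
  exact mul_nonpos_of_nonneg_of_nonpos (hA.nonneg_eigenvalues rfl i) (hM _)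

theorem traceHessian_nonpos_of_isLocalMax {A : E →L[ℝ] E} {u : E → ℝ} {x : E}
    (hA : A.IsPositive) (hu : ContDiffAt ℝ 2 u x) (hmax : IsLocalMax u x) :
    traceHessian A u x ≤ 0 :=
  trace_comp_nonpos hA (inner_hessian_nonpos_of_isLocalMax hu hmax)

/-- `u` is a classical subsolution on `s` of the equation `tr (A D²u) = 0`. -/
structure IsSubsolutionOn (A : E → E →L[ℝ] E) (u : E → ℝ) (s : Set E) : Prop where
  contDiffOn : ContDiffOn ℝ 2 u s
  nonneg : ∀ x ∈ s, 0 ≤ traceHessian (A x) u x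

theorem IsSubsolutionOn.mono {A : E → E →L[ℝ] E} {u : E → ℝ} {s t : Set E}
    (hu : IsSubsolutionOn A u t) (hst : s ⊆ t) : IsSubsolutionOn A u s :=
  ⟨hu.contDiffOn.mono hst, fun x hx => hu.nonneg x (hst hx)⟩

theorem trace_le_of_inner_le {A : E →ₗ[ℝ] E} {L : ℝ} (hA : ∀ v, ⟪v, A v⟫ ≤ L * ‖v‖ ^ 2) :
    LinearMap.trace ℝ E A ≤ finrank ℝ E * L := by
  let b := stdOrthonormalBasis ℝ E
  rw [LinearMap.trace_eq_sum_inner _ b]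
  calc ∑ i, ⟪b i, A (b i)⟫ ≤ ∑ _i : Fin (finrank ℝ E), L :=
        Finset.sum_le_sum fun i _ => by simpa using hA (b i)
    _ = finrank ℝ E * L := by simp

theorem traceHessian_gaussian (A : E →L[ℝ] E) (α : ℝ) (y x : E) :
    traceHessian A (gaussian α y) x = gaussian α y x *
      (4 * α ^ 2 * ⟪x - y, A (x - y)⟫ - 2 * α * LinearMap.trace ℝ E A.toLinearMap) := by
  have h : (A ∘L hessian (gaussian α y) x).toLinearMap
      = gaussian α y x • ((4 * α ^ 2) • (innerₗ E (x - y)).smulRight (A (x - y))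
        - (2 * α) • A.toLinearMap) := by
    ext v
    simp [hessian_gaussian_apply, smul_smul, inner_sub_left]
  rw [traceHessian, h]
  simp [LinearMap.trace_smulRight, inner_sub_left]

theorem IsUniformlyEllipticOn.exists_traceHessian_gaussian_pos {A : E → E →L[ℝ] E} {s : Set E}
    (hA : IsUniformlyEllipticOn A s) {r : ℝ} (hr : 0 < r) :
    ∃ α > 0, ∀ y, ∀ x ∈ s, r ≤ dist x y → 0 < traceHessian (A x) (gaussian α y) x := by
  obtain ⟨l, hl, L, h⟩ := hA.exists_bounds
  set T := (finrank ℝ E : ℝ) * L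
  refine ⟨(|T| + 1) / (l * r ^ 2), by positivity, fun y x hx hxy => ?_⟩
  set α := (|T| + 1) / (l * r ^ 2) with hα
  have hα0 : 0 < α := by positivity
  have htrace : LinearMap.trace ℝ E (A x).toLinearMap ≤ T :=
    trace_le_of_inner_le fun v => (h x hx v).2
  have hinner : |T| + 1 ≤ α * ⟪x - y, A x (x - y)⟫ := by
    rw [dist_eq_norm] at hxy
    calc |T| + 1 = α * (l * r ^ 2) := by rw [hα]; field_simp
      _ ≤ α * (l * ‖x - y‖ ^ 2) := by gcongr
      _ ≤ α * ⟪x - y, A x (x - y)⟫ := by gcongr; exact (h x hx _).1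
  rw [traceHessian_gaussian]
  refine mul_pos (Real.exp_pos _) ?_
  have hmain : 0 < 2 * (α * ⟪x - y, A x (x - y)⟫) - LinearMap.trace ℝ E (A x).toLinearMap := by
    linarith [le_abs_self T, abs_nonneg T]
  linarith [mul_pos (by positivity : 0 < 2 * α) hmain]

theorem not_isLocalMax_add_const_mul {A : E →L[ℝ] E} {u v : E → ℝ} {x : E} {ε : ℝ}
    (hA : A.IsPositive) (hu : ContDiffAt ℝ 2 u x) (hv : ContDiffAt ℝ 2 v x)
    (hu0 : 0 ≤ traceHessian A u x) (hv0 : 0 < traceHessian A v x) (hε : 0 < ε) :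
    ¬ IsLocalMax (fun p => u p + ε * v p) x := by
  intro hmax
  have hnonpos := traceHessian_nonpos_of_isLocalMax hA (hu.add (contDiffAt_const.mul hv)) hmax
  rw [traceHessian_add_const_mul _ _ hu hv] at hnonpos
  linarith [mul_pos hε hv0]

theorem exists_isMaxOn_add_gaussian {A : E → E →L[ℝ] E} {u : E → ℝ} {y z : E} {R : ℝ}
    (hA : IsUniformlyEllipticOn A (ball y R)) (hu : IsSubsolutionOn A u (ball y R))
    (huc : ContinuousOn u (closedBall y R)) (hR : 0 < R) (hz : dist z y = R)
    (hlt : ∀ x ∈ ball y R, u x < u z) :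
    ∃ α > 0, ∃ ε > 0, IsMaxOn (fun p => u p + ε * gaussian α y p) (closedBall y R) z := by
  obtain ⟨q, hq, hqmax⟩ := (isCompact_closedBall y (R / 2)).exists_isMaxOn
    (nonempty_closedBall.2 (by positivity)) (huc.mono (closedBall_subset_closedBall (by linarith)))
  obtain ⟨α, hα, hpos⟩ := hA.exists_traceHessian_gaussian_pos (half_pos hR)
  set ε := u z - u q with hε
  have hε0 : 0 < ε := sub_pos.2 (hlt q (closedBall_subset_ball (by linarith) hq))
  have hle : ∀ x ∈ closedBall y R, u x ≤ u z := by
    rw [← closure_ball y hR.ne'] at huc ⊢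
    exact fun x hx => closure_minimal (t := Iic (u z))
      (image_subset_iff.2 fun p hp => (hlt p hp).le) isClosed_Iic
      (huc.image_closure (mem_image_of_mem u hx))
  refine ⟨α, hα, ε, hε0, ?_⟩
  have hwc : ContinuousOn (fun p => u p + ε * gaussian α y p) (closedBall y R) :=
    huc.add (continuousOn_const.mul (contDiff_gaussian (m := 0) α y).continuous.continuousOn)
  obtain ⟨x, hx, hxmax⟩ := (isCompact_closedBall y R).exists_isMaxOn
    (nonempty_closedBall.2 hR.le) hwc
  suffices h : u x + ε * gaussian α y x ≤ u z + ε * gaussian α y z from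
    fun p hp => (hxmax hp).trans h
  rcases lt_or_ge (dist x y) (R / 2) with hinner | houter
  · have h1 : u x ≤ u q := hqmax (mem_closedBall.2 hinner.le)
    have h2 : gaussian α y x ≤ 1 := Real.exp_le_one_iff.2 (by nlinarith [sq_nonneg ‖x - y‖])
    have h3 : 0 < gaussian α y z := Real.exp_pos _
    nlinarith
  rcases (mem_closedBall.1 hx).eq_or_lt with hsphere | hball
  · have h1 : gaussian α y x = gaussian α y z := by
      simp only [gaussian, ← dist_eq_norm, hsphere, hz]
    rw [h1]
    gcongr
    exact hle x hx
  · have hnhds : ball y R ∈ 𝓝 x := isOpen_ball.mem_nhds hball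
    have hux : ContDiffAt ℝ 2 u x := hu.contDiffOn.contDiffAt hnhds
    have hgx : ContDiffAt ℝ 2 (gaussian α y) x := (contDiff_gaussian α y).contDiffAt
    exact absurd ((hxmax.on_subset ball_subset_closedBall).isLocalMax hnhds)
      (not_isLocalMax_add_const_mul (hA.isPositive hball) hux hgx (hu.nonneg x hball)
        (hpos y x hball houter) hε0)

theorem hopf_not_hasFDerivWithinAt_zero {A : E → E →L[ℝ] E} {u : E → ℝ} {y z : E} {R : ℝ}
    (hA : IsUniformlyEllipticOn A (ball y R)) (hu : IsSubsolutionOn A u (ball y R))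
    (huc : ContinuousOn u (closedBall y R)) (hR : 0 < R) (hz : dist z y = R)
    (hlt : ∀ x ∈ ball y R, u x < u z) :
    ¬ HasFDerivWithinAt u (0 : E →L[ℝ] ℝ) (closedBall y R) z := by
  intro hder
  obtain ⟨α, hα, ε, hε, hmax⟩ := exists_isMaxOn_add_gaussian hA hu huc hR hz hlt
  have hzy : 0 < ‖z - y‖ := by rwa [← dist_eq_norm, hz]
  have hinward : y - z ∈ posTangentConeAt (closedBall y R) z :=
    sub_mem_posTangentConeAt_of_segment_subset ((convex_closedBall y R).segment_subset
      (mem_closedBall.2 hz.le) (mem_closedBall_self hR.le))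
  have hnonpos := hmax.localize.hasFDerivWithinAt_nonpos (hder.add
    ((hasGradientAt_gaussian α y z).hasFDerivAt.const_mul ε).hasFDerivWithinAt) hinward
  have hval : ε * (-2 * α * gaussian α y z * ⟪z - y, y - z⟫)
      = 2 * (ε * α * gaussian α y z * ‖z - y‖ ^ 2) := by
    rw [← neg_sub z y, inner_neg_right, real_inner_self_eq_norm_sq]
    ring
  have hgpos : 0 < gaussian α y z := Real.exp_pos _
  simp only [zero_add, smul_apply, InnerProductSpace.toDual_apply_apply,
    inner_smul_left, RCLike.conj_to_real, smul_eq_mul, hval] at hnonpos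
  exact hnonpos.not_gt (by positivity)

theorem eventually_eq_of_isMaxOn_of_subsolution {A : E → E →L[ℝ] E} {u : E → ℝ} {ω : Set E}
    {z₀ : E} (hω : IsOpen ω) (hA : IsUniformlyEllipticOn A ω) (hu : IsSubsolutionOn A u ω)
    (hz₀ : z₀ ∈ ω) (hmax : IsMaxOn u ω z₀) : ∀ᶠ x in 𝓝 z₀, u x = u z₀ := by
  obtain ⟨d, hd, hdω⟩ := Metric.isOpen_iff.1 hω z₀ hz₀
  have hcbω : closedBall z₀ (d / 2) ⊆ ω := (closedBall_subset_ball (by linarith)).trans hdω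
  set Z := closedBall z₀ (d / 2) ∩ u ⁻¹' {u z₀}
  have hZ : IsCompact Z := (isCompact_closedBall z₀ (d / 2)).of_isClosed_subset
    ((hu.contDiffOn.continuousOn.mono hcbω).preimage_isClosed_of_isClosed isClosed_closedBall
      isClosed_singleton) inter_subset_left
  have hz₀Z : z₀ ∈ Z := ⟨mem_closedBall_self (by positivity), rfl⟩
  filter_upwards [ball_mem_nhds z₀ (show 0 < d / 4 by positivity)] with q hq
  by_contra hne
  obtain ⟨z, hz, hzq⟩ := hZ.exists_infDist_eq_dist ⟨z₀, hz₀Z⟩ q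
  have hzpos : 0 < dist z q := dist_pos.2 (by rintro rfl; exact hne hz.2)
  have hball : closedBall q (dist z q) ⊆ closedBall z₀ (d / 2) := by
    refine closedBall_subset_closedBall' ?_
    have h1 : dist q z ≤ dist q z₀ := hzq ▸ infDist_le_dist_of_mem hz₀Z
    rw [dist_comm q z] at h1
    linarith [mem_ball.1 hq]
  have hsub : ball q (dist z q) ⊆ ω := ball_subset_closedBall.trans (hball.trans hcbω)
  refine hopf_not_hasFDerivWithinAt_zero (hA.mono hsub) (hu.mono hsub)
    (hu.contDiffOn.continuousOn.mono (hball.trans hcbω)) hzpos rfl (fun x hx => ?_) ?_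
  · rw [hz.2]
    refine lt_of_le_of_ne (hmax (hsub hx)) fun hxz => ?_
    rw [dist_comm z q, ← hzq] at hx
    exact disjoint_left.1 disjoint_ball_infDist hx
      ⟨hball (by rw [dist_comm z q, ← hzq]; exact ball_subset_closedBall hx), hxz⟩
  · have hzω : ω ∈ 𝓝 z := hω.mem_nhds (hcbω hz.1)
    have hloc : IsLocalMax u z := by
      filter_upwards [hzω] with x hx
      rw [hz.2]
      exact hmax hx
    rw [← hloc.fderiv_eq_zero]
    exact ((hu.contDiffOn.contDiffAt hzω).differentiableAt
      (by norm_num)).hasFDerivAt.hasFDerivWithinAt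

theorem strong_maximum_principle {A : E → E →L[ℝ] E} {u : E → ℝ} {ω : Set E} {z₀ : E}
    (hω : IsOpen ω) (hconn : IsPreconnected ω) (hA : IsUniformlyEllipticOn A ω)
    (hu : IsSubsolutionOn A u ω) (hz₀ : z₀ ∈ ω) (hmax : IsMaxOn u ω z₀) :
    EqOn u (fun _ => u z₀) ω := by
  set Z := {x | x ∈ ω ∧ u x = u z₀}
  have hopen : IsOpen Z := by
    refine isOpen_iff_mem_nhds.2 fun z hz => ?_
    have hzmax : IsMaxOn u ω z := fun x hx => (hmax hx).trans hz.2.ge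
    filter_upwards [hω.mem_nhds hz.1, eventually_eq_of_isMaxOn_of_subsolution hω hA hu hz.1 hzmax]
      with x hxω hx using ⟨hxω, hx.trans hz.2⟩
  have hclosed : closure Z ∩ ω ⊆ Z := fun x ⟨hxZ, hxω⟩ =>
    ⟨hxω, closure_minimal (t := {u z₀}) (image_subset_iff.2 fun p hp => hp.2) isClosed_singleton
      (((hu.contDiffOn.continuousOn x hxω).mono fun _ hp => hp.1).mem_closure_image hxZ)⟩
  exact fun x hx => (hconn.subset_of_closure_inter_subset hopen ⟨z₀, hz₀, hz₀, rfl⟩ hclosed hx).2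

end SecondOrder

section Boundary

theorem eq_zero_of_mem_frontier {X : Type*} [TopologicalSpace X] {ω : Set X} {ρ : X → ℝ} {p : X}
    (hρ : ContinuousAt ρ p) (h : ∀ᶠ x in 𝓝 p, x ∈ ω ↔ ρ x < 0) (hp : p ∈ frontier ω) :
    ρ p = 0 := by
  rw [frontier_eq_closure_inter_closure, mem_inter_iff, mem_closure_iff_frequently,
    mem_closure_iff_frequently] at hp
  by_contra hne
  rcases lt_or_gt_of_ne hne with hlt | hgt
  · exact hp.2 (((hρ.eventually_lt_const hlt).and h).mono fun x hx => not_not.2 (hx.2.2 hx.1))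
  · exact hp.1 (((hρ.eventually_const_lt hgt).and h).mono
      fun x hx hxω => (hx.2.1 hxω).not_gt hx.1)

variable {E : Type*} [NormedAddCommGroup E] [InnerProductSpace ℝ E] [CompleteSpace E]

/-- Near `p`, the set `ω` is the region `{ρ < 0}` below a regular level of the `C²` function `ρ`;
at `p ∈ ∂ω` the gradient of `ρ` is then an exterior normal to `ω`. -/
structure IsLocalDefiningFunction (ω : Set E) (ρ : E → ℝ) (p : E) : Prop where
  contDiffAt : ContDiffAt ℝ 2 ρ p
  gradient_ne_zero : ∇ ρ p ≠ 0
  eventually_mem_iff : ∀ᶠ x in 𝓝 p, x ∈ ω ↔ ρ x < 0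

theorem IsLocalDefiningFunction.eventually_eq_zero_of_mem_frontier {ω : Set E} {ρ : E → ℝ} {p : E}
    (hρ : IsLocalDefiningFunction ω ρ p) : ∀ᶠ x in 𝓝 p, x ∈ frontier ω → ρ x = 0 := by
  filter_upwards [hρ.eventually_mem_iff.eventually_nhds, hρ.contDiffAt.eventually (by norm_num)]
    with x hmem hdiff
  exact eq_zero_of_mem_frontier hdiff.continuousAt hmem

/-- A set with `C²` boundary, lying locally on one side of it. -/
def HasC2Boundary (ω : Set E) : Prop :=
  ∀ p ∈ frontier ω, ∃ ρ, IsLocalDefiningFunction ω ρ p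

/-- The homogeneous Neumann condition: at each boundary point the gradient from inside of `u` is
orthogonal to the normal of `ω`. -/
def HasZeroNormalDerivative (u : E → ℝ) (ω : Set E) : Prop :=
  ∀ p ∈ frontier ω, ∀ ρ, IsLocalDefiningFunction ω ρ p →
    ∀ g, HasGradientWithinAt u g (closure ω) p → ⟪g, ∇ ρ p⟫ = 0

theorem HasZeroNormalDerivative.neg {u : E → ℝ} {ω : Set E} (hu : HasZeroNormalDerivative u ω) :
    HasZeroNormalDerivative (-u) ω := by
  intro p hp ρ hρ g hg
  have hneg : HasGradientWithinAt u (-g) (closure ω) p := by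
    rw [hasGradientWithinAt_iff_hasFDerivWithinAt, map_neg]
    simpa using hg.hasFDerivWithinAt.neg
  simpa [inner_neg_left] using hu p hp ρ hρ (-g) hneg

theorem exists_quadratic_upper_bound {ρ : E → ℝ} {p : E} (hρ : ContDiffAt ℝ 2 ρ p) :
    ∃ C, ∀ᶠ x in 𝓝 p, ρ x ≤ ρ p + ⟪∇ ρ p, x - p⟫ + C * ‖x - p‖ ^ 2 := by
  obtain ⟨C, t, ht, hlip⟩ := (hρ.fderiv_right (m := 1) (by norm_num)).exists_lipschitzOnWith
  have hdiff : ∀ᶠ x in 𝓝 p, DifferentiableAt ℝ ρ x :=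
    (hρ.eventually (by norm_num)).mono fun x hx => hx.differentiableAt (by norm_num)
  obtain ⟨r, hr, hball⟩ := Metric.mem_nhds_iff.1 (inter_mem ht hdiff)
  refine ⟨C, mem_of_superset (ball_mem_nhds p hr) fun x hx => ?_⟩
  have hsub : closedBall p ‖x - p‖ ⊆ ball p r := closedBall_subset_ball (by rwa [← dist_eq_norm])
  have hbound : ∀ q ∈ closedBall p ‖x - p‖, ‖fderiv ℝ ρ q - fderiv ℝ ρ p‖ ≤ C * ‖x - p‖ := by
    intro q hq
    rw [← dist_eq_norm]
    exact (hlip.dist_le_mul q (hball (hsub hq)).1 p (mem_of_mem_nhds ht)).trans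
      (by gcongr; exact hq)
  have htaylor := (convex_closedBall p ‖x - p‖).norm_image_sub_le_of_norm_fderiv_le' (𝕜 := ℝ)
    (fun q hq => (hball (hsub hq)).2) hbound (mem_closedBall_self (norm_nonneg _))
    (by rw [mem_closedBall, dist_eq_norm])
  rw [← inner_gradient_left] at htaylor
  change ρ x ≤ _
  linarith [(le_abs_self _).trans htaylor]

theorem IsLocalDefiningFunction.interior_sphere_condition {ω : Set E} {ρ : E → ℝ} {p : E}
    (hρ : IsLocalDefiningFunction ω ρ p) (hp : p ∈ frontier ω) :
    ∃ y R, 0 < R ∧ dist p y = R ∧ ball y R ⊆ ω := by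
  obtain ⟨C, hquad⟩ := exists_quadratic_upper_bound hρ.contDiffAt
  rw [hρ.eventually_eq_zero_of_mem_frontier.self_of_nhds hp] at hquad
  obtain ⟨r, hr, hball⟩ := Metric.mem_nhds_iff.1 (hquad.and hρ.eventually_mem_iff)
  set g := ∇ ρ p
  have hg : 0 < ‖g‖ := norm_pos_iff.2 hρ.gradient_ne_zero
  have hsmall : ∀ c b : ℝ, 0 < b → ∀ᶠ t : ℝ in 𝓝[>] 0, c * t < b := fun c b hb =>
    nhdsWithin_le_nhds ((continuous_const_mul c).continuousAt.eventually_lt_const (by simpa))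
  obtain ⟨t, ⟨htr, htC⟩, ht : 0 < t⟩ := (((hsmall (2 * ‖g‖) r hr).and
    (hsmall (2 * C) 1 one_pos)).and self_mem_nhdsWithin).exists
  have hdist : dist p (p - t • g) = t * ‖g‖ := by
    rw [dist_eq_norm, sub_sub_cancel, norm_smul, Real.norm_of_nonneg ht.le]
  refine ⟨p - t • g, t * ‖g‖, by positivity, hdist, fun x hx => ?_⟩
  have hxr : x ∈ ball p r := by
    rw [mem_ball] at hx ⊢
    linarith [dist_triangle_right x p (p - t • g), dist_triangle x (p - t • g) p,
      dist_comm (p - t • g) p]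
  have hnorm : ‖x - p‖ ^ 2 + 2 * t * ⟪g, x - p⟫ < 0 := by
    have h : ‖(x - p) + t • g‖ ^ 2 < (t * ‖g‖) ^ 2 := by
      rw [mem_ball, dist_eq_norm, ← sub_add] at hx
      gcongr
    rw [norm_add_sq_real, norm_smul, Real.norm_of_nonneg ht.le, inner_smul_right,
      real_inner_comm] at h
    linarith
  refine (hball hxr).2.2 ((hball hxr).1.trans_lt ?_)
  nlinarith [mul_le_mul_of_nonneg_right htC.le (sq_nonneg ‖x - p‖)]

theorem HasC2Boundary.uniqueDiffOn_closure {ω : Set E} (hω : IsOpen ω) (hbd : HasC2Boundary ω) :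
    UniqueDiffOn ℝ (closure ω) := by
  intro p hp
  by_cases hpω : p ∈ ω
  · exact (hω.uniqueDiffWithinAt hpω).mono subset_closure
  have hpf : p ∈ frontier ω := by rw [hω.frontier_eq]; exact ⟨hp, hpω⟩
  obtain ⟨ρ, hρ⟩ := hbd p hpf
  obtain ⟨y, R, hR, hpy, hball⟩ := hρ.interior_sphere_condition hpf
  refine (uniqueDiffWithinAt_convex (convex_ball y R) ?_ ?_).mono (hball.trans subset_closure)
  · rw [isOpen_ball.interior_eq]
    exact nonempty_ball.2 hR
  · rw [closure_ball y hR.ne']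
    exact hpy.le

theorem IsLocalDefiningFunction.mem_posTangentConeAt {ω : Set E} {ρ : E → ℝ} {p v : E}
    (hρ : IsLocalDefiningFunction ω ρ p) (hp : p ∈ frontier ω) (hv : ⟪∇ ρ p, v⟫ < 0) :
    v ∈ posTangentConeAt ω p := by
  have hline : HasDerivAt (fun t : ℝ => p + t • v) v 0 := by
    simpa using ((hasDerivAt_id (0 : ℝ)).smul_const v).const_add p
  have hderiv : HasDerivAt (fun t : ℝ => ρ (p + t • v)) ⟪∇ ρ p, v⟫ 0 := by
    have h : HasFDerivAt ρ (fderiv ℝ ρ p) (p + (0 : ℝ) • v) := by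
      simpa using (hρ.contDiffAt.differentiableAt (by norm_num)).hasFDerivAt
    rw [inner_gradient_left]
    exact h.comp_hasDerivAt (0 : ℝ) hline
  have hzero : ρ (p + (0 : ℝ) • v) = 0 := by
    simpa using hρ.eventually_eq_zero_of_mem_frontier.self_of_nhds hp
  have hmem : ∀ᶠ t : ℝ in 𝓝[>] 0, p + t • v ∈ ω ↔ ρ (p + t • v) < 0 :=
    (hline.continuousAt.tendsto.eventually (p := fun x => x ∈ ω ↔ ρ x < 0)
      (by simpa using hρ.eventually_mem_iff)).filter_mono nhdsWithin_le_nhds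
  have hneg : ∀ᶠ t : ℝ in 𝓝[>] 0, ρ (p + t • v) < 0 := by
    have hsign := eventually_nhdsWithin_sign_eq_of_deriv_neg (by rwa [hderiv.deriv]) hzero
    filter_upwards [nhdsWithin_le_nhds hsign, self_mem_nhdsWithin] with t ht (ht0 : 0 < t)
    rwa [← sign_eq_neg_one_iff, ht, zero_sub, sign_eq_neg_one_iff, neg_lt_zero]
  refine mem_posTangentConeAt_of_frequently_mem (Eventually.frequently ?_)
  filter_upwards [hmem, hneg] with t h1 h2 using h1.2 h2

theorem IsLocalDefiningFunction.eq_zero_of_isMaxOn {ω : Set E} {ρ u : E → ℝ} {p g : E}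
    (hρ : IsLocalDefiningFunction ω ρ p) (hp : p ∈ frontier ω)
    (hu : HasGradientWithinAt u g (closure ω) p) (hneumann : ⟪g, ∇ ρ p⟫ = 0)
    (hmax : IsMaxOn u (closure ω) p) : g = 0 := by
  have hinward : g - ∇ ρ p ∈ posTangentConeAt ω p := by
    refine hρ.mem_posTangentConeAt hp ?_
    rw [inner_sub_right, real_inner_comm, hneumann, real_inner_self_eq_norm_sq]
    have hnorm : 0 < ‖∇ ρ p‖ := norm_pos_iff.2 hρ.gradient_ne_zero
    linarith [pow_pos hnorm 2]
  have hle := hmax.localize.hasFDerivWithinAt_nonpos hu.hasFDerivWithinAt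
    (posTangentConeAt_mono subset_closure hinward)
  rw [InnerProductSpace.toDual_apply_apply, inner_sub_right, hneumann, sub_zero,
    real_inner_self_eq_norm_sq] at hle
  exact norm_eq_zero.1 (pow_eq_zero_iff two_ne_zero |>.1 (hle.antisymm (sq_nonneg _)))

end Boundary

section Neumann

variable {E : Type*} [NormedAddCommGroup E] [InnerProductSpace ℝ E] [FiniteDimensional ℝ E]

theorem HasC2Boundary.exists_norm_gradient_le {ω : Set E} {u : E → ℝ} (hω : IsOpen ω)
    (hbd : HasC2Boundary ω) (hb : Bornology.IsBounded ω) (hu : ContDiffOn ℝ 1 u (closure ω)) :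
    ∃ K, ∀ x ∈ ω, ‖∇ u x‖ ≤ K := by
  obtain ⟨K, hK⟩ := hb.isCompact_closure.exists_bound_of_continuousOn
    (hu.continuousOn_fderivWithin (hbd.uniqueDiffOn_closure hω) le_rfl)
  refine ⟨K, fun x hx => ?_⟩
  rw [← (InnerProductSpace.toDual ℝ E).norm_map, toDual_gradient,
    ← fderivWithin_of_mem_nhds (mem_of_superset (hω.mem_nhds hx) subset_closure)]
  exact hK x (subset_closure hx)

/-- Hopf's lemma excludes that the maximum is attained on the boundary only. -/
theorem eqOn_const_of_subsolution_of_neumann {A : E → E →L[ℝ] E} {u : E → ℝ} {ω : Set E}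
    (hω : IsOpen ω) (hconn : IsConnected ω) (hb : Bornology.IsBounded ω) (hbd : HasC2Boundary ω)
    (hA : IsUniformlyEllipticOn A ω) (hu : IsSubsolutionOn A u ω)
    (hdiff : DifferentiableOn ℝ u (closure ω)) (hneumann : HasZeroNormalDerivative u ω) :
    ∃ c, EqOn u (fun _ => c) (closure ω) := by
  have huc : ContinuousOn u (closure ω) := hdiff.continuousOn
  obtain ⟨p, hp, hpmax⟩ := hb.isCompact_closure.exists_isMaxOn hconn.nonempty.closure huc
  have hmax : IsMaxOn u ω p := hpmax.on_subset subset_closure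
  by_cases hex : ∃ z ∈ ω, u z = u p
  · obtain ⟨z, hz, hzp⟩ := hex
    have hzmax : IsMaxOn u ω z := fun x hx => (hmax hx).trans hzp.ge
    exact ⟨u z, (strong_maximum_principle hω hconn.isPreconnected hA hu hz
      hzmax).of_subset_closure huc continuousOn_const subset_closure subset_rfl⟩
  push Not at hex
  have hpf : p ∈ frontier ω := by
    rw [hω.frontier_eq]
    exact ⟨hp, fun h => hex p h rfl⟩
  obtain ⟨ρ, hρ⟩ := hbd p hpf
  obtain ⟨y, R, hR, hpy, hball⟩ := hρ.interior_sphere_condition hpf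
  have hcball : closedBall y R ⊆ closure ω := by
    rw [← closure_ball y hR.ne']
    exact closure_mono hball
  have hgrad := (hdiff p hp).hasGradientWithinAt
  have hgrad0 := hρ.eq_zero_of_isMaxOn hpf hgrad (hneumann p hpf ρ hρ _ hgrad) hpmax
  rw [hgrad0, hasGradientWithinAt_iff_hasFDerivWithinAt, map_zero] at hgrad
  exact absurd (hgrad.mono hcball) (hopf_not_hasFDerivWithinAt_zero (hA.mono hball)
    (hu.mono hball) (huc.mono hcball) hR hpy
    fun x hx => lt_of_le_of_ne (hmax (hball hx)) (hex x (hball hx)))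

end Neumann

theorem fderivWithin_comp_eq_of_hasFDerivAt {E F G : Type*} [NormedAddCommGroup E]
    [NormedSpace ℝ E] [NormedAddCommGroup F] [NormedSpace ℝ F] [NormedAddCommGroup G]
    [NormedSpace ℝ G] {f : F → G} {γ : E → F} {S : Set F} {x : E} {γ' : E →L[ℝ] F}
    {D : E →L[ℝ] G} (hf : DifferentiableWithinAt ℝ f S (γ x)) (hγ : HasFDerivAt γ γ' x)
    (hS : ∀ᶠ y in 𝓝 x, γ y ∈ S) (hD : HasFDerivAt (f ∘ γ) D x) :
    fderivWithin ℝ f S (γ x) ∘L γ' = D :=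
  (hf.hasFDerivWithinAt.comp_hasFDerivAt x hγ hS).unique hD

section NormalSpace

variable {F : Type*} [NormedAddCommGroup F] [InnerProductSpace ℝ F] [FiniteDimensional ℝ F]

theorem gradient_mem_normalSpaceAt {S : Set F} {p a : F} {f : F → ℝ}
    (hf : HasGradientWithinAt f a S p) (hconst : ∀ᶠ q in 𝓝[S] p, f q = f p) :
    a ∈ normalSpaceAt S p := by
  have hzero : HasFDerivWithinAt f (0 : F →L[ℝ] ℝ) S p :=
    (hasFDerivWithinAt_const (f p) p S).congr_of_eventuallyEq hconst rfl
  have hle : tangentSpaceAt S p ≤ LinearMap.ker (innerₗ F a) :=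
    Submodule.span_le.2 fun w hw => hf.hasFDerivWithinAt.unique_on hzero hw
  refine (Submodule.mem_orthogonal' _ _).2 fun w hw => hle hw

theorem meanCurvature_eq_of_range_eq {V : Type*} [AddCommGroup V] [Module ℝ V] {Γ : Set F}
    {ν : F → F} {p : F} {ι : V →ₗ[ℝ] F} (hι : Function.Injective ι)
    (hrange : tangentSpaceAt Γ p = LinearMap.range ι) {B : V →ₗ[ℝ] V}
    (hB : ∀ v, fderivWithin ℝ ν Γ p (ι v) = ι (B v)) :
    meanCurvature Γ ν p = LinearMap.trace ℝ V B / finrank ℝ V := by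
  let e : V ≃ₗ[ℝ] tangentSpaceAt Γ p :=
    (LinearEquiv.ofInjective ι hι).trans (LinearEquiv.ofEq _ _ hrange.symm)
  have he : ∀ v, (e v : F) = ι v := fun v => rfl
  have hconj : shapeOperator Γ ν p = e.conj B := by
    refine LinearMap.ext fun w => ?_
    obtain ⟨v, rfl⟩ := e.surjective w
    have hshape : shapeOperator Γ ν p (e v)
        = (tangentSpaceAt Γ p).orthogonalProjectionOnto (e (B v)) := by
      rw [he, ← hB]
      rfl
    rw [hshape, Submodule.orthogonalProjectionOnto_mem_subspace_eq_self,
      LinearEquiv.conj_apply_apply, LinearEquiv.symm_apply_apply]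
  rw [meanCurvature, hconj, LinearMap.trace_conj', ← e.finrank_eq]

end NormalSpace

section GraphTangent

variable {E : Type*} [NormedAddCommGroup E] [InnerProductSpace ℝ E]

/-- The parametrization `x ↦ (x, φ x)` of the graph of `φ`. -/
def graphMap (φ : E → ℝ) (x : E) : WithLp 2 (E × ℝ) :=
  WithLp.toLp 2 (x, φ x)

/-- The differential `v ↦ (v, ⟪g, v⟫)` of the parametrization of a graph at a point where the
gradient is `g`. -/
def graphLift (g : E) : E →L[ℝ] WithLp 2 (E × ℝ) :=
  (WithLp.prodContinuousLinearEquiv 2 ℝ E ℝ).symm.toContinuousLinearMap ∘L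
    (ContinuousLinearMap.id ℝ E).prod (innerSL ℝ g)

/-- The upward unit normal of a graph at a point where the gradient is `g`. -/
def upwardUnitNormal (g : E) : WithLp 2 (E × ℝ) :=
  (√(1 + ‖g‖ ^ 2))⁻¹ • WithLp.toLp 2 (-g, 1)

/-- The inverse `I - g ⊗ g / (1 + |g|²)` of the first fundamental form `I + g ⊗ g` of a graph at a
point where the gradient is `g`. -/
def graphInverseMetric (g : E) : E →L[ℝ] E :=
  ContinuousLinearMap.id ℝ E - (1 + ‖g‖ ^ 2)⁻¹ • InnerProductSpace.rankOne ℝ g g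

theorem graphInverseMetric_apply (g v : E) :
    graphInverseMetric g v = v - ((1 + ‖g‖ ^ 2)⁻¹ * ⟪g, v⟫) • g := by
  simp [graphInverseMetric, smul_smul]

theorem graphLift_injective (g : E) : Function.Injective (graphLift g) :=
  fun _ _ h => congrArg WithLp.fst h

theorem inner_graphLift (g v : E) (w : WithLp 2 (E × ℝ)) :
    ⟪graphLift g v, w⟫ = ⟪v, w.fst + w.snd • g⟫ := by
  rw [WithLp.prod_inner_apply, inner_add_right, inner_smul_right, real_inner_comm g v]
  simp [graphLift]

theorem inner_graphInverseMetric_self_bounds (g v : E) :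
    (1 + ‖g‖ ^ 2)⁻¹ * ‖v‖ ^ 2 ≤ ⟪v, graphInverseMetric g v⟫ ∧
      ⟪v, graphInverseMetric g v⟫ ≤ ‖v‖ ^ 2 := by
  have hexpand : ⟪v, graphInverseMetric g v⟫ = ‖v‖ ^ 2 - (1 + ‖g‖ ^ 2)⁻¹ * ⟪g, v⟫ ^ 2 := by
    rw [graphInverseMetric_apply, inner_sub_right, inner_smul_right, real_inner_comm g v,
      real_inner_self_eq_norm_sq]
    ring
  have hcauchy : ⟪g, v⟫ ^ 2 ≤ ‖g‖ ^ 2 * ‖v‖ ^ 2 := by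
    rw [← mul_pow, sq_le_sq, abs_of_nonneg (by positivity : 0 ≤ ‖g‖ * ‖v‖)]
    exact abs_real_inner_le_norm g v
  have hcancel : (1 + ‖g‖ ^ 2)⁻¹ * (1 + ‖g‖ ^ 2) = 1 := inv_mul_cancel₀ (by positivity)
  rw [hexpand]
  refine ⟨?_, sub_le_self _ (by positivity)⟩
  linear_combination (1 + ‖g‖ ^ 2)⁻¹ * hcauchy + ‖v‖ ^ 2 * hcancel

theorem isUniformlyEllipticOn_graphInverseMetric {G : E → E} {s : Set E} {K : ℝ}
    (hG : ∀ x ∈ s, ‖G x‖ ≤ K) : IsUniformlyEllipticOn (fun x => graphInverseMetric (G x)) s where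
  isSymmetric x _ v w := by
    simp only [ContinuousLinearMap.coe_coe, graphInverseMetric_apply, inner_sub_left,
      inner_sub_right, inner_smul_left, inner_smul_right, RCLike.conj_to_real,
      real_inner_comm (G x) v]
    ring
  exists_bounds := by
    refine ⟨(1 + K ^ 2)⁻¹, by positivity, 1, fun x hx v => ?_⟩
    have hbounds := inner_graphInverseMetric_self_bounds (G x) v
    rw [one_mul]
    refine ⟨le_trans ?_ hbounds.1, hbounds.2⟩
    gcongr
    exact hG x hx

theorem hasFDerivAt_upwardUnitNormal (g : E) :
    HasFDerivAt upwardUnitNormal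
      (-(√(1 + ‖g‖ ^ 2))⁻¹ • (graphLift g ∘L graphInverseMetric g)) g := by
  have hpos : 0 < 1 + ‖g‖ ^ 2 := by positivity
  have hscale : HasFDerivAt (fun h : E => (√(1 + ‖h‖ ^ 2))⁻¹)
      (-((√(1 + ‖g‖ ^ 2))⁻¹ * (1 + ‖g‖ ^ 2)⁻¹) • innerSL ℝ g) g := by
    have hroot := (((hasFDerivAt_id g).norm_sq.const_add 1).sqrt hpos.ne')
    refine ((hasDerivAt_inv (Real.sqrt_pos.2 hpos).ne').comp_hasFDerivAt g hroot).congr_fderiv ?_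
    ext v
    simp only [id_eq, ContinuousLinearMap.comp_id, neg_smul, neg_apply, smul_apply,
      coe_innerSL_apply, nsmul_eq_mul, Nat.cast_ofNat, smul_eq_mul]
    field_simp
    rw [Real.sq_sqrt hpos.le]
  have hpair : HasFDerivAt (fun h : E => (WithLp.toLp 2 (-h, 1) : WithLp 2 (E × ℝ)))
      ((WithLp.prodContinuousLinearEquiv 2 ℝ E ℝ).symm.toContinuousLinearMap ∘L
        (-ContinuousLinearMap.id ℝ E).prod 0) g :=
    (WithLp.prodContinuousLinearEquiv 2 ℝ E ℝ).symm.hasFDerivAt.comp g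
      ((hasFDerivAt_id g).neg.prodMk (hasFDerivAt_const 1 g))
  have hcancel : (1 + ‖g‖ ^ 2)⁻¹ * (1 + ‖g‖ ^ 2) = 1 := inv_mul_cancel₀ hpos.ne'
  refine (hscale.smul hpair).congr_fderiv (ContinuousLinearMap.ext fun v => ?_)
  have hinner : ⟪g, graphInverseMetric g v⟫ = (1 + ‖g‖ ^ 2)⁻¹ * ⟪g, v⟫ := by
    rw [graphInverseMetric_apply, inner_sub_right, inner_smul_right, real_inner_self_eq_norm_sq]
    linear_combination (-⟪g, v⟫) * hcancel
  refine congrArg (WithLp.toLp 2) (Prod.ext ?_ ?_)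
  · change (√(1 + ‖g‖ ^ 2))⁻¹ • -v
        + (-((√(1 + ‖g‖ ^ 2))⁻¹ * (1 + ‖g‖ ^ 2)⁻¹) * ⟪g, v⟫) • -g
      = -(√(1 + ‖g‖ ^ 2))⁻¹ • graphInverseMetric g v
    rw [graphInverseMetric_apply]
    module
  · simp [graphLift, hinner, mul_assoc]

theorem eq_upwardUnitNormal {g : E} {ν : WithLp 2 (E × ℝ)} (hnorm : ‖ν‖ = 1)
    (hnormal : ∀ v, ⟪graphLift g v, ν⟫ = 0) (hup : 0 ≤ ⟪WithLp.toLp 2 (-g, (1 : ℝ)), ν⟫) :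
    ν = upwardUnitNormal g := by
  have hfst : ν.fst = -(ν.snd • g) := by
    refine eq_neg_of_add_eq_zero_left (ext_inner_left ℝ fun v => ?_)
    rw [← inner_graphLift, hnormal, inner_zero_right]
  have hsq : ν.snd ^ 2 * (1 + ‖g‖ ^ 2) = 1 := by
    have h := WithLp.prod_norm_sq_eq_of_L2 ν
    rw [hnorm, hfst, norm_neg, norm_smul, mul_pow, Real.norm_eq_abs, sq_abs] at h
    linarith
  have hnonneg : 0 ≤ ν.snd := by
    have h : ⟪WithLp.toLp 2 (-g, (1 : ℝ)), ν⟫ = ν.snd * (1 + ‖g‖ ^ 2) := by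
      calc ⟪WithLp.toLp 2 (-g, (1 : ℝ)), ν⟫ = ⟪-g, ν.fst⟫ + ν.snd * 1 := rfl
        _ = ν.snd * (1 + ‖g‖ ^ 2) := by
          rw [hfst, inner_neg_neg, inner_smul_right, real_inner_self_eq_norm_sq]
          ring
    exact nonneg_of_mul_nonneg_left (h ▸ hup) (by positivity)
  have hsnd : ν.snd = (√(1 + ‖g‖ ^ 2))⁻¹ := by
    rw [← Real.sqrt_inv, eq_comm, Real.sqrt_eq_iff_mul_self_eq (by positivity) hnonneg, ← sq]
    exact (eq_inv_of_mul_eq_one_left hsq).symm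
  refine congrArg (WithLp.toLp 2) (Prod.ext ?_ ?_)
  · simpa [hsnd] using hfst
  · simpa using hsnd

variable [CompleteSpace E]

theorem hasFDerivAt_graphMap {φ : E → ℝ} {g x : E} (hφ : HasGradientAt φ g x) :
    HasFDerivAt (graphMap φ) (graphLift g) x :=
  (WithLp.prodContinuousLinearEquiv 2 ℝ E ℝ).symm.hasFDerivAt.comp x
    ((hasFDerivAt_id x).prodMk hφ.hasFDerivAt)

theorem hasGradientWithinAt_comp_fst {f : E → ℝ} {g : E} {A : Set E} {S : Set (WithLp 2 (E × ℝ))}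
    {p : WithLp 2 (E × ℝ)} (hf : HasGradientWithinAt f g A p.fst) (hS : MapsTo WithLp.fst S A) :
    HasGradientWithinAt (fun q : WithLp 2 (E × ℝ) => f q.fst) (WithLp.toLp 2 (g, 0)) S p := by
  have h := hf.hasFDerivWithinAt.comp (f := WithLp.fst) p
    (WithLp.fstL 2 ℝ E ℝ).hasFDerivWithinAt hS
  rw [hasGradientWithinAt_iff_hasFDerivWithinAt]
  refine h.congr_fderiv (ContinuousLinearMap.ext fun w => ?_)
  simp

theorem hasGradientWithinAt_snd_sub {φ : E → ℝ} {g : E} {A : Set E} {S : Set (WithLp 2 (E × ℝ))}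
    {p : WithLp 2 (E × ℝ)} (hφ : HasGradientWithinAt φ g A p.fst) (hS : MapsTo WithLp.fst S A) :
    HasGradientWithinAt (fun q : WithLp 2 (E × ℝ) => q.snd - φ q.fst) (WithLp.toLp 2 (-g, 1))
      S p := by
  have h := (WithLp.sndL 2 ℝ E ℝ).hasFDerivWithinAt.sub
    (hasGradientWithinAt_comp_fst hφ hS).hasFDerivWithinAt
  rw [hasGradientWithinAt_iff_hasFDerivWithinAt]
  refine h.congr_fderiv (ContinuousLinearMap.ext fun w => ?_)
  change w.snd - (⟪g, w.fst⟫ + w.snd * 0) = ⟪-g, w.fst⟫ + w.snd * 1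
  rw [inner_neg_left]
  ring

end GraphTangent

section GraphCurvature

variable {n : ℕ} {ω : Set (Base n)} {φ : Base n → ℝ}

theorem image_graphMap (ω : Set (Base n)) (φ : Base n → ℝ) : graphMap φ '' ω = graph ω φ := by
  ext q
  constructor
  · rintro ⟨x, hx, rfl⟩
    exact ⟨hx, rfl⟩
  · exact fun hq => ⟨q.fst, hq.1, congrArg (WithLp.toLp 2) (Prod.ext rfl hq.2.symm)⟩

theorem upwardNormal_mem_normalSpaceAt_graph {A : Set (Base n)} {x g : Base n}
    (hφ : HasGradientWithinAt φ g A x) :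
    (WithLp.toLp 2 (-g, 1) : Ambient n) ∈ normalSpaceAt (graph A φ) (graphMap φ x) := by
  refine gradient_mem_normalSpaceAt (f := fun q => q.snd - φ q.fst)
    (hasGradientWithinAt_snd_sub hφ fun q hq => hq.1) ?_
  filter_upwards [self_mem_nhdsWithin] with q hq
  rw [hq.2, sub_self]
  exact (sub_self (φ x)).symm

theorem tangentSpaceAt_graph (hω : IsOpen ω) {x g : Base n} (hx : x ∈ ω)
    (hφ : HasGradientAt φ g x) :
    tangentSpaceAt (graph ω φ) (graphMap φ x) = LinearMap.range (graphLift g).toLinearMap := by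
  refine le_antisymm (fun w hw => LinearMap.mem_range.2 ⟨w.fst, ?_⟩) ?_
  · have hnormal := upwardNormal_mem_normalSpaceAt_graph (A := ω)
      hφ.hasFDerivAt.hasFDerivWithinAt
    have h : ⟪w.fst, -g⟫ + 1 * w.snd = 0 := (Submodule.mem_orthogonal _ _).1 hnormal w hw
    rw [inner_neg_right, real_inner_comm] at h
    exact congrArg (WithLp.toLp 2) (Prod.ext rfl (by linarith : ⟪g, w.fst⟫ = w.snd))
  · rintro _ ⟨v, rfl⟩
    have h := ((hasFDerivAt_graphMap hφ).hasFDerivWithinAt (s := ω)).mapsTo_tangent_cone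
    rw [tangentConeAt_of_mem_nhds (hω.mem_nhds hx), image_graphMap] at h
    exact Submodule.subset_span (h (mem_univ v))

theorem IsExteriorUnitNormal.eq_upwardUnitNormal {ν : Ambient n → Ambient n}
    (hν : IsExteriorUnitNormal (subgraph ω φ) (graph ω φ) ν) (hω : IsOpen ω) {x g : Base n}
    (hx : x ∈ ω) (hφ : HasGradientAt φ g x) : ν (graphMap φ x) = upwardUnitNormal g := by
  have hmem : graphMap φ x ∈ graph ω φ := ⟨hx, rfl⟩
  refine CMCGraph.eq_upwardUnitNormal (hν.norm_eq_one _ hmem) (fun v => ?_) ?_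
  · refine (Submodule.mem_orthogonal _ _).1 (hν.normal _ hmem) _ ?_
    rw [tangentSpaceAt_graph hω hx hφ]
    exact LinearMap.mem_range_self _ v
  · have hcone : -ν (graphMap φ x) ∈ posTangentConeAt (subgraph ω φ) (graphMap φ x) := by
      refine mem_posTangentConeAt_of_frequently_mem (Eventually.frequently ?_)
      filter_upwards [hν.inside _ hmem] with t ht
      rwa [smul_neg, ← sub_eq_add_neg]
    have hmax : IsLocalMaxOn (fun q : Ambient n => q.snd - φ q.fst) (subgraph ω φ)
        (graphMap φ x) := by
      filter_upwards [self_mem_nhdsWithin] with q hq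
      exact (sub_neg.2 hq.2.2).le.trans_eq (sub_self (φ x)).symm
    have h := hmax.hasFDerivWithinAt_nonpos (hasGradientWithinAt_snd_sub
      (hasGradientWithinAt_univ.2 hφ) (mapsTo_univ _ _)).hasFDerivWithinAt hcone
    rwa [map_neg, neg_nonpos, InnerProductSpace.toDual_apply_apply] at h

theorem fderivWithin_exteriorUnitNormal {ν : Ambient n → Ambient n}
    (hν : IsExteriorUnitNormal (subgraph ω φ) (graph ω φ) ν)
    (hdiff : DifferentiableOn ℝ ν (graph ω φ)) (hω : IsOpen ω) (hφ : ContDiffOn ℝ 2 φ ω)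
    {x : Base n} (hx : x ∈ ω) (v : Base n) :
    fderivWithin ℝ ν (graph ω φ) (graphMap φ x) (graphLift (∇ φ x) v)
      = graphLift (∇ φ x) ((-(√(1 + ‖∇ φ x‖ ^ 2))⁻¹ •
          (graphInverseMetric (∇ φ x) ∘L hessian φ x)) v) := by
  have hgrad : ∀ y ∈ ω, HasGradientAt φ (∇ φ y) y := fun y hy =>
    (hasGradientAt_of_contDiffAt (hφ.contDiffAt (hω.mem_nhds hy))).self_of_nhds
  have heq : ν ∘ graphMap φ =ᶠ[𝓝 x] upwardUnitNormal ∘ ∇ φ := by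
    filter_upwards [hω.mem_nhds hx] with y hy
    exact hν.eq_upwardUnitNormal hω hy (hgrad y hy)
  have hcomp := fderivWithin_comp_eq_of_hasFDerivAt
    (hdiff (graphMap φ x) ⟨hx, rfl⟩) (hasFDerivAt_graphMap (hgrad x hx))
    ((hω.eventually_mem hx).mono fun y hy => ⟨hy, rfl⟩)
    (((hasFDerivAt_upwardUnitNormal (∇ φ x)).comp x
      (hasFDerivAt_gradient (hφ.contDiffAt (hω.mem_nhds hx)))).congr_of_eventuallyEq heq)
  exact (DFunLike.congr_fun hcomp v).trans (map_smul (graphLift (∇ φ x)) _ _).symm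

theorem traceHessian_eq_of_hasConstantMeanCurvature {H : ℝ} (hn : 1 ≤ n) (hω : IsOpen ω)
    (hφ : ContDiffOn ℝ 2 φ ω) (hH : HasConstantMeanCurvature (subgraph ω φ) (graph ω φ) H)
    {x : Base n} (hx : x ∈ ω) :
    traceHessian (graphInverseMetric (∇ φ x)) φ x
      = -(n * H * √(1 + ‖∇ φ x‖ ^ 2)) := by
  obtain ⟨ν, hν, hdiff, hνH⟩ := hH
  have hgrad := (hasGradientAt_of_contDiffAt (hφ.contDiffAt (hω.mem_nhds hx))).self_of_nhds
  have hcurv := meanCurvature_eq_of_range_eq (graphLift_injective (∇ φ x))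
    (tangentSpaceAt_graph hω hx hgrad)
    (fderivWithin_exteriorUnitNormal hν hdiff hω hφ hx)
  rw [hνH (graphMap φ x) ⟨hx, rfl⟩, finrank_euclideanSpace_fin, eq_div_iff (by positivity),
    ContinuousLinearMap.toLinearMap_smul, map_smul, smul_eq_mul, ← traceHessian] at hcurv
  have hroot : √(1 + ‖∇ φ x‖ ^ 2) ≠ 0 := by positivity
  field_simp at hcurv
  linarith

end GraphCurvature

section LateralBoundary

variable {n : ℕ} {ω : Set (Base n)} {φ : Base n → ℝ}

theorem mem_lateralBoundary_iff {q : Ambient n} :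
    q ∈ lateralBoundary ω ↔ q.fst ∈ frontier ω ∧ 0 < q.snd := by
  let e := (WithLp.prodContinuousLinearEquiv 2 ℝ (Base n) ℝ).toHomeomorph
  have hfrontier : frontier (halfCylinder ω) = e ⁻¹' frontier (ω ×ˢ Ioi (0 : ℝ)) :=
    (e.preimage_frontier (ω ×ˢ Ioi (0 : ℝ))).symm
  rw [lateralBoundary, hfrontier, frontier_prod_eq, closure_Ioi, frontier_Ioi]
  constructor
  · rintro ⟨h | h, hq⟩
    · exact absurd h.2 hq.ne'
    · exact ⟨h.1, hq⟩
  · exact fun h => ⟨Or.inr ⟨h.1, h.2.le⟩, h.2⟩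

theorem closure_graph (hb : Bornology.IsBounded ω) (hφ : ContinuousOn φ (closure ω)) :
    closure (graph ω φ) = graph (closure ω) φ := by
  rw [← image_graphMap, ← image_graphMap]
  refine (image_closure_of_isCompact hb.isCompact_closure ?_).symm
  exact (WithLp.prodContinuousLinearEquiv 2 ℝ (Base n) ℝ).symm.continuous.comp_continuousOn
    (continuousOn_id.prodMk hφ)

theorem hasZeroNormalDerivative_of_meetsOrthogonally (hb : Bornology.IsBounded ω)
    (hφ : ContinuousOn φ (closure ω)) (hpos : ∀ x ∈ frontier ω, 0 < φ x)
    (horth : MeetsOrthogonally (graph ω φ) (lateralBoundary ω)) :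
    HasZeroNormalDerivative φ ω := by
  intro x hx ρ hρ g hg
  have hxcl : x ∈ closure ω := frontier_subset_closure hx
  have hgraph : (WithLp.toLp 2 (-g, 1) : Ambient n)
      ∈ normalSpaceAt (closure (graph ω φ)) (graphMap φ x) := by
    rw [closure_graph hb hφ]
    exact upwardNormal_mem_normalSpaceAt_graph hg
  have hlateral : (WithLp.toLp 2 (∇ ρ x, 0) : Ambient n)
      ∈ normalSpaceAt (lateralBoundary ω) (graphMap φ x) := by
    have hgrad := (hρ.contDiffAt.differentiableAt (by norm_num)).hasGradientAt
    refine gradient_mem_normalSpaceAt (f := fun q => ρ q.fst) (hasGradientWithinAt_comp_fst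
      (hasGradientWithinAt_univ.2 hgrad) (mapsTo_univ _ _)) ?_
    have hzero := hρ.eventually_eq_zero_of_mem_frontier
    filter_upwards [nhdsWithin_le_nhds ((WithLp.fstL 2 ℝ (Base n) ℝ).continuous.tendsto
      (graphMap φ x) hzero), self_mem_nhdsWithin] with q hq hqS
    exact (hq (mem_lateralBoundary_iff.1 hqS).1).trans (hzero.self_of_nhds hx).symm
  have hmem : graphMap φ x ∈ closure (graph ω φ) ∩ lateralBoundary ω := by
    rw [closure_graph hb hφ]
    exact ⟨⟨hxcl, rfl⟩, mem_lateralBoundary_iff.2 ⟨hx, hpos x hx⟩⟩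
  have h : ⟪-g, ∇ ρ x⟫ + 0 * 1 = 0 := horth _ hmem _ hgraph _ hlateral
  simpa [inner_neg_left] using h

end LateralBoundary

section Rigidity

variable {n : ℕ} {ω : Set (Base n)} {φ : Base n → ℝ}

theorem IsSmoothBoundedDomain.hasC2Boundary (hω : IsSmoothBoundedDomain ω) :
    HasC2Boundary ω := by
  intro p hp
  obtain ⟨U, ρ, hU, hpU, hρ, hd, hsub⟩ := hω.smooth_boundary p hp
  refine ⟨ρ, (hρ.contDiffAt (hU.mem_nhds hpU)).of_le
    (WithTop.coe_le_coe.2 (le_top : (2 : ℕ∞) ≤ ⊤)), fun h => hd ?_, ?_⟩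
  · rw [← toDual_gradient, h, map_zero]
  · filter_upwards [hU.mem_nhds hpU] with x hx
    simpa [hx] using Set.ext_iff.1 hsub x

theorem eqOn_const_of_hasConstantMeanCurvature {H : ℝ} (hn : 1 ≤ n) (hω : IsOpen ω)
    (hconn : IsConnected ω) (hb : Bornology.IsBounded ω) (hbd : HasC2Boundary ω)
    (hφ : ContDiffOn ℝ 2 φ ω) (hφ' : ContDiffOn ℝ 1 φ (closure ω))
    (hH : HasConstantMeanCurvature (subgraph ω φ) (graph ω φ) H)
    (hneumann : HasZeroNormalDerivative φ ω) : ∃ c, EqOn φ (fun _ => c) (closure ω) := by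
  obtain ⟨K, hK⟩ := hbd.exists_norm_gradient_le hω hb hφ'
  have helliptic := isUniformlyEllipticOn_graphInverseMetric hK
  have hdiff : DifferentiableOn ℝ φ (closure ω) := hφ'.differentiableOn one_ne_zero
  have heq : ∀ x ∈ ω, traceHessian (graphInverseMetric (∇ φ x)) φ x
      = -(n * H * √(1 + ‖∇ φ x‖ ^ 2)) := fun x hx =>
    traceHessian_eq_of_hasConstantMeanCurvature hn hω hφ hH hx
  rcases le_total H 0 with hneg | hpos
  · refine eqOn_const_of_subsolution_of_neumann hω hconn hb hbd helliptic
      ⟨hφ, fun x hx => ?_⟩ hdiff hneumann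
    rw [heq x hx, mul_right_comm, neg_nonneg]
    exact mul_nonpos_of_nonneg_of_nonpos (by positivity) hneg
  · have hsub : IsSubsolutionOn (fun x => graphInverseMetric (∇ φ x)) (-φ) ω := by
      refine ⟨hφ.neg, fun x hx => ?_⟩
      rw [traceHessian_neg _ (hφ.contDiffAt (hω.mem_nhds hx)), heq x hx, neg_neg]
      positivity
    obtain ⟨c, hc⟩ := eqOn_const_of_subsolution_of_neumann hω hconn hb hbd helliptic hsub
      hdiff.neg hneumann.neg
    exact ⟨-c, fun x hx => neg_eq_iff_eq_neg.1 (hc hx)⟩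

theorem eq_zero_of_hasConstantMeanCurvature_of_eqOn_const {H c : ℝ} (hn : 1 ≤ n) (hω : IsOpen ω)
    (hne : ω.Nonempty) (hH : HasConstantMeanCurvature (subgraph ω φ) (graph ω φ) H)
    (hc : EqOn φ (fun _ => c) ω) : H = 0 := by
  obtain ⟨x, hx⟩ := hne
  have heq := traceHessian_eq_of_hasConstantMeanCurvature hn hω (contDiffOn_const.congr hc) hH hx
  rw [traceHessian, hessian_eq_zero_of_eventuallyEq_const (hc.eventuallyEq_of_mem
    (hω.mem_nhds hx)), ContinuousLinearMap.comp_zero, ContinuousLinearMap.toLinearMap_zero,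
    map_zero, eq_comm, neg_eq_zero] at heq
  have hroot : √(1 + ‖∇ φ x‖ ^ 2) ≠ 0 := by positivity
  have hn0 : (n : ℝ) ≠ 0 := by positivity
  simpa [hroot, hn0] using heq

end Rigidity

end CMCGraph

end

open CMCGraph in
theorem proposition2p1_general {n : ℕ} {ω : Set (Base n)} {φ : Base n → ℝ} {H : ℝ} (hn : 1 ≤ n)
    (hω : IsOpen ω) (hconn : IsConnected ω) (hb : Bornology.IsBounded ω)
    (hbd : HasC2Boundary ω) (hφ : ContDiffOn ℝ 2 φ ω) (hφ' : ContDiffOn ℝ 1 φ (closure ω))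
    (hpos : ∀ x ∈ frontier ω, 0 < φ x)
    (hH : HasConstantMeanCurvature (subgraph ω φ) (graph ω φ) H)
    (horth : MeetsOrthogonally (graph ω φ) (lateralBoundary ω)) :
    H = 0 ∧ ∃ c : ℝ, ∀ x ∈ closure ω, φ x = c := by
  have hneumann := hasZeroNormalDerivative_of_meetsOrthogonally hb hφ'.continuousOn hpos horth
  obtain ⟨c, hc⟩ := eqOn_const_of_hasConstantMeanCurvature hn hω hconn hb hbd hφ hφ' hH hneumann
  exact ⟨eq_zero_of_hasConstantMeanCurvature_of_eqOn_const hn hω hconn.nonempty hH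
    (hc.mono subset_closure), c, hc⟩

theorem proposition2p1 (n : ℕ) (hn : 1 ≤ n)
    (ω : Set (CMCGraph.Base n)) (hω : CMCGraph.IsSmoothBoundedDomain ω)
    (φ : CMCGraph.Base n → ℝ) (hφ : ContDiffOn ℝ 2 φ (closure ω))
    (hpos : ∀ x ∈ closure ω, 0 < φ x)
    (H : ℝ)
    (hH : CMCGraph.HasConstantMeanCurvature (CMCGraph.subgraph ω φ) (CMCGraph.graph ω φ) H)
    (horth : CMCGraph.MeetsOrthogonally (CMCGraph.graph ω φ) (CMCGraph.lateralBoundary ω)) :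
    H = 0 ∧ ∃ c : ℝ, ∀ x ∈ closure ω, φ x = c :=
  proposition2p1_general hn hω.isOpen hω.isConnected hω.isBounded hω.hasC2Boundary
    (hφ.mono subset_closure) (hφ.of_le (by norm_num))
    (fun x hx => hpos x (frontier_subset_closure hx)) hH horth
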